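/- Let $N\ge 1$, and let $\mathsf E_{ij}$ denote the $3\times 3$ matrix units. In $\mathfrak{sl}(3,\mathbb C)$ take the bases $\mathsf X_1=\tfrac13(2\mathsf E_{11}-\mathsf E_{22}-\mathsf E_{33})$, $\mathsf X_2=\tfrac13(\mathsf E_{11}+\mathsf E_{22}-2\mathsf E_{33})$, $\mathsf X_3=\mathsf E_{21}$, $\mathsf X_4=\mathsf E_{32}$, $\mathsf X_5=\mathsf E_{31}$, $\mathsf X_6=\mathsf E_{12}$, $\mathsf X_7=\mathsf E_{23}$, $\mathsf X_8=\mathsf E_{13}$ and $\mathsf X_1^*=\mathsf E_{11}-\mathsf E_{22}$, $\mathsf X_2^*=\mathsf E_{22}-\mathsf E_{33}$, $\mathsf X_3^*=\mathsf E_{12}$, $\mathsf X_4^*=\mathsf E_{23}$, $\mathsf X_5^*=\mathsf E_{13}$, $\mathsf X_6^*=\mathsf E_{21}$, $\mathsf X_7^*=\mathsf E_{32}$, $\mathsf X_8^*=\mathsf E_{31}$, which are dual with respect to $\operatorname{tr}(XY)$. For $\ell\ge 0$ put $\mathsf X_{a;\ell}=\mathsf X_a z^\ell$ and $$\mathsf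 X^*_{a;\ell}=z^{-\ell-1}\mathsf X_a^*+\delta_{\ell,0}\big(\delta_{a,5}(\mathsf E_{21}-2\mathsf E_{32})-\delta_{a,3}\mathsf E_{31}-\delta_{a,4}\mathsf E_{31}\big),$$ and let $\langle A,B\rangle=\operatorname{res}_{z=0}\operatorname{tr}\big(A(z)B(z)\big)$. Let $\mathcal M_N\cong\mathbb C^{8N}$ be the manifold of the matrices $$\mathsf L_N(z)=z\mathsf E_{31}+\mathsf E_{12}+\mathsf E_{23}+\sum_{\ell=0}^{N-1}\sum_{a=1}^8 L_{a;\ell}\,\mathsf X^*_{a;\ell}$$ with coordinates $L_{a;\ell}$, equipped with the Lie–Poisson bracket $$\{\mathcal F,\mathcal H\}=\sum_{\ell,\ell'=0}^{N-1}\sum_{a,b=1}^8\big\langle \mathsf L_N(z),[\mathsf X_{a;\ell},\mathsf X_{b;\ell'}]\big\rangle\frac{\partial\mathcal F}{\partial L_{a;\ell}}\frac{\partial\mathcal H}{\partial L_{b;\ell'}}.$$ Put $p_a(z)=\sum_{m=1}^N L_{a;m-1}z^{N-m}$ and $\alpha_1=p_1$, $\alpha_2=p_2$, $\beta_1=p_3$,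 $\beta_2=p_4$, $\beta_3=p_5$, $\gamma_1=p_6$, $\beta_{3;1}=L_{5;0}$, and $$B_2(z)=-\begin{vmatrix}\alpha_1(z)&\beta_3(z)\\ \beta_{3;1}z^N+\gamma_1(z)&z^N+\beta_2(z)\end{vmatrix},\qquad B_3(z)=\begin{vmatrix}z^N+\beta_1(z)&\beta_3(z)\\ \alpha_2(z)-\alpha_1(z)&z^N+\beta_2(z)\end{vmatrix}-z^{2N}.$$ For each point of $\mathcal M_N$ consider the system in the unknowns $(z,w)\in\mathbb C^2$ $$w\big(z^N+\beta_2(z)\big)+B_2(z)=0,\qquad w\,\beta_3(z)+\big(z^{2N}+B_3(z)\big)=0.\tag{1}$$ **Theorem.** (i) Every point of $\mathcal M_N$ at which (1) has exactly $3N$ distinct solutions has an open neighbourhood $U$ with continuous functions $z_k,w_k:U\to\mathbb C$, $1\le k\le 3N$, such that at each point of $U$ the pairs $(z_k,w_k)$ are pairwise distinct and are precisely the solutions of (1). (ii) Let $U\subseteq\mathcal M_N$ be any open set and let $z_k,w_k:U\to\mathbb C$, $1\le k\le 3N$, be any continuous functions with that property. Then all $z_k$ and $w_k$ are holomorphic on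 $U$, and they are quasi-canonically conjugate with respect to the Lie–Poisson bracket: for all $k,l$, at every point of $U$, $$\{z_k,z_l\}=0,\qquad\{w_k,w_l\}=0,\qquad\{z_k,w_l\}=z_k^N\,\delta_{kl}.$$ -/

import Mathlib

open scoped LaurentPolynomial

noncomputable section

namespace Boussinesq

/-- `3 × 3` matrices whose entries are Laurent polynomials in the spectral parameter `z = T 1`. -/
abbrev LoopMat : Type := Matrix (Fin 3) (Fin 3) ℂ[T;T⁻¹]

/-- The matrix unit `E_{ij}`, with indices `i, j ∈ {0, 1, 2}`. -/
def E (i j : Fin 3) : Matrix (Fin 3) (Fin 3) ℂ := Matrix.single i j 1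

/-- The constant matrix `A` times `z ^ n`. -/
def monomialMat (A : Matrix (Fin 3) (Fin 3) ℂ) (n : ℤ) : LoopMat :=
  A.map fun c => LaurentPolynomial.C c * LaurentPolynomial.T n

/-- The basis `X_1, …, X_8` of `𝔰𝔩(3)` (numbered from `0`). -/
def slBasis : Fin 8 → Matrix (Fin 3) (Fin 3) ℂ :=
  ![(1 / 3 : ℂ) • ((2 : ℂ) • E 0 0 - E 1 1 - E 2 2),
    (1 / 3 : ℂ) • (E 0 0 + E 1 1 - (2 : ℂ) • E 2 2),
    E 1 0, E 2 1, E 2 0, E 0 1, E 1 2, E 0 2]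

/-- The basis of `𝔰𝔩(3)` that is dual to `slBasis` under the form `(X, Y) ↦ tr (X Y)`. -/
def slDual : Fin 8 → Matrix (Fin 3) (Fin 3) ℂ :=
  ![E 0 0 - E 1 1, E 1 1 - E 2 2, E 0 1, E 1 2, E 0 2, E 1 0, E 2 1, E 2 0]

/-- The loop algebra element `X_{a;ℓ} = X_a z ^ ℓ`. -/
def loopBasis (a : Fin 8) (l : ℕ) : LoopMat := monomialMat (slBasis a) l

/-- The constant part of the element `X*_{a;0}` of the dual basis produced by the `r`-matrix. -/
def dualCorrection : Fin 8 → Matrix (Fin 3) (Fin 3) ℂ :=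
  ![0, 0, -E 2 0, -E 2 0, E 1 0 - (2 : ℂ) • E 2 1, 0, 0, 0]

/-- The dual basis element `X*_{a;ℓ}`. -/
def loopDual (a : Fin 8) (l : ℕ) : LoopMat :=
  monomialMat (slDual a) (-(l : ℤ) - 1) + if l = 0 then monomialMat (dualCorrection a) 0 else 0

/-- The shift element `s(z) = z E_31 + E_12 + E_23`. -/
def shiftElement : LoopMat := monomialMat (E 2 0) 1 + monomialMat (E 0 1) 0 + monomialMat (E 1 2) 0

/-- The pairing `⟨A, B⟩ = res_{z = 0} tr (A(z) B(z))`. -/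
def pairing (A B : LoopMat) : ℂ := (A * B).trace.coeff (-1)

/-- The manifold `𝓜_N`, through its global coordinates, the dynamic variables `L_{a;ℓ}`. -/
abbrev DynVars (N : ℕ) : Type := Fin 8 × Fin N → ℂ

/-- The Lax matrix `L_N(z)` of the point of `𝓜_N` with the dynamic variables `L`. -/
def laxMatrix {N : ℕ} (L : DynVars N) : LoopMat :=
  shiftElement +
    ∑ l : Fin N, ∑ a : Fin 8, LaurentPolynomial.C (L (a, l)) • loopDual a (l : ℕ)

/-- The entry `⟨L_N(z), [X_{a;ℓ}, X_{b;ℓ'}]⟩` of the Poisson tensor. -/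
def poissonTensor {N : ℕ} (L : DynVars N) (p q : Fin 8 × Fin N) : ℂ :=
  pairing (laxMatrix L) ⁅loopBasis p.1 (p.2 : ℕ), loopBasis q.1 (q.2 : ℕ)⁆

/-- The partial derivative `∂F/∂L_{a;ℓ}` at the point `L`, where `p = (a, ℓ)`. -/
def partialD {N : ℕ} (F : DynVars N → ℂ) (p : Fin 8 × Fin N) (L : DynVars N) : ℂ :=
  fderiv ℂ F L (Pi.single p 1)

/-- The value at the point `L` of the Lie-Poisson bracket `{F, H}`. -/
def liePoisson {N : ℕ} (F H : DynVars N → ℂ) (L : DynVars N) : ℂ :=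
  ∑ p : Fin 8 × Fin N, ∑ q : Fin 8 × Fin N,
    poissonTensor L p q * partialD F p L * partialD H q L

/-- The polynomial `∑_{m=1}^N L_{a;m-1} z ^ (N - m)`. -/
def dynPoly {N : ℕ} (a : Fin 8) (L : DynVars N) (z : ℂ) : ℂ :=
  ∑ m : Fin N, L (a, m) * z ^ (N - 1 - (m : ℕ))

section Polynomials

variable {N : ℕ}

/-- `α_1(z)` -/
def α₁ (L : DynVars N) (z : ℂ) : ℂ := dynPoly 0 L z
/-- `α_2(z)` -/
def α₂ (L : DynVars N) (z : ℂ) : ℂ := dynPoly 1 L z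
/-- `β_1(z)` -/
def β₁ (L : DynVars N) (z : ℂ) : ℂ := dynPoly 2 L z
/-- `β_2(z)` -/
def β₂ (L : DynVars N) (z : ℂ) : ℂ := dynPoly 3 L z
/-- `β_3(z)` -/
def β₃ (L : DynVars N) (z : ℂ) : ℂ := dynPoly 4 L z
/-- `γ_1(z)` -/
def γ₁ (L : DynVars N) (z : ℂ) : ℂ := dynPoly 5 L z

/-- The leading coefficient `β_{3;1}` of `β_3(z)`. -/
def β₃₁ [NeZero N] (L : DynVars N) : ℂ := L (4, 0)

/-- The polynomial `B_2(z)`. -/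
def B₂ [NeZero N] (L : DynVars N) (z : ℂ) : ℂ :=
  -(!![α₁ L z, β₃ L z;
       β₃₁ L * z ^ N + γ₁ L z, z ^ N + β₂ L z]).det

/-- The polynomial `B_3(z)`. -/
def B₃ (L : DynVars N) (z : ℂ) : ℂ :=
  (!![z ^ N + β₁ L z, β₃ L z;
      α₂ L z - α₁ L z, z ^ N + β₂ L z]).det - z ^ (2 * N)

/-- The set of common zeros `(z, w)` of the system that defines the divisor. -/
def divisorZeros [NeZero N] (L : DynVars N) : Set (ℂ × ℂ) :=
  {P | P.2 * (P.1 ^ N + β₂ L P.1) + B₂ L P.1 = 0 ∧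
       P.2 * β₃ L P.1 + (P.1 ^ (2 * N) + B₃ L P.1) = 0}

/-- The functions `z_k, w_k` are, on the set `U` of `𝓜_N`, the coordinates of the points of the
divisor: they depend continuously on the point of `U`, the `3N` points `(z_k, w_k)` are pairwise
distinct, and they are precisely the common zeros of the system. -/
structure IsDivisorCoords [NeZero N] (U : Set (DynVars N))
    (z w : Fin (3 * N) → DynVars N → ℂ) : Prop where
  continuousOn_z : ∀ k, ContinuousOn (z k) U
  continuousOn_w : ∀ k, ContinuousOn (w k) U
  injective : ∀ L ∈ U, Function.Injective fun k => (z k L, w k L)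
  range_eq : ∀ L ∈ U, Set.range (fun k => (z k L, w k L)) = divisorZeros L

end Polynomials

end Boussinesq

end

noncomputable section

/-! ### The Poisson tensor, and brackets of the generating polynomials -/

namespace Boussinesq

variable {N : ℕ}

/-! The left sides of (1) are two minors m₁, m₂ of z^N L_N(z) - w, both affine in w. Write K = z^N +
β₂ and C = β₃ for their coefficients of w, and J for their Jacobian in (z, w).

Counting: R = K m₂ - C m₁ is free of w and monic of degree 3N in z (`eval_resultantPoly`,
`monic_resultantPoly`). Two zeros over one z would make the whole vertical line consist of zeros, so
3N zeros have 3N distinct z, which are then all the roots of R, each simple. At a zero R' = -J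
(`eval_derivative_resultantPoly`), hence J ≠ 0. The implicit function theorem then yields both the
local coordinates and the holomorphy of any continuous ones.

Brackets: implicit differentiation gives J dz = K dm₂ - C dm₁ and J dw = (∂_z m₂) dm₁ - (∂_z m₁)
dm₂, where dm₁, dm₂ are taken at frozen (z, w). It remains to bracket minors at two points. Each
minor commutes with itself at a different z, and (z - y){m₁, m₂} is a combination of the minors
(`poissonForm_covector₁_covector₂`), so all brackets vanish between distinct zeros. At a single zero
the confluent form is {m₁, m₂} = z^N J (`poissonForm_covector_self`), and dividing by J² leaves {z,
w} = z^N. -/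

lemma monomialMat_mul (A B : Matrix (Fin 3) (Fin 3) ℂ) (m n : ℤ) :
    monomialMat A m * monomialMat B n = monomialMat (A * B) (m + n) := by
  ext1 i j
  simp only [monomialMat, Matrix.mul_apply, Matrix.map_apply, map_sum, map_mul,
    LaurentPolynomial.T_add, Finset.sum_mul]
  exact Finset.sum_congr rfl fun k _ => by ring

lemma monomialMat_sub (A B : Matrix (Fin 3) (Fin 3) ℂ) (n : ℤ) :
    monomialMat (A - B) n = monomialMat A n - monomialMat B n := by
  ext1 i j
  simp [monomialMat, sub_mul]

lemma monomialMat_lie (A B : Matrix (Fin 3) (Fin 3) ℂ) (m n : ℤ) :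
    ⁅monomialMat A m, monomialMat B n⁆ = monomialMat ⁅A, B⁆ (m + n) := by
  rw [Ring.lie_def, Ring.lie_def, monomialMat_mul, monomialMat_mul, monomialMat_sub, add_comm n m]

lemma pairing_monomialMat (A B : Matrix (Fin 3) (Fin 3) ℂ) (m n : ℤ) :
    pairing (monomialMat A m) (monomialMat B n) = if m + n = -1 then (A * B).trace else 0 := by
  have h : (monomialMat (A * B) (m + n)).trace
      = LaurentPolynomial.C (A * B).trace * LaurentPolynomial.T (m + n) := by
    simp [monomialMat, Matrix.trace, Finset.sum_mul]
  rw [pairing, monomialMat_mul, h, ← LaurentPolynomial.single_eq_C_mul_T,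
    AddMonoidAlgebra.coeff_single, Finsupp.single_apply]

lemma pairing_add_left (A B X : LoopMat) : pairing (A + B) X = pairing A X + pairing B X := by
  simp [pairing, add_mul, Matrix.trace_add]

lemma pairing_sum_left {ι : Type*} (s : Finset ι) (A : ι → LoopMat) (X : LoopMat) :
    pairing (∑ i ∈ s, A i) X = ∑ i ∈ s, pairing (A i) X := by
  simp [pairing, Finset.sum_mul, Matrix.trace_sum]

lemma pairing_C_smul_left (c : ℂ) (A X : LoopMat) :
    pairing (LaurentPolynomial.C c • A) X = c * pairing A X := by
  rw [pairing, Matrix.smul_mul, Matrix.trace_smul, smul_eq_mul, ← LaurentPolynomial.smul_eq_C_mul,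
    AddMonoidAlgebra.coeff_smul_apply, smul_eq_mul, pairing]

/-- The constant correction has no residue against a nonnegative power of z, so it never reaches the
Poisson tensor. The same holds for the shift element. -/
lemma pairing_loopDual (a : Fin 8) (l n : ℕ) (A : Matrix (Fin 3) (Fin 3) ℂ) :
    pairing (loopDual a l) (monomialMat A n) = if l = n then (slDual a * A).trace else 0 := by
  have h0 : pairing (if l = 0 then monomialMat (dualCorrection a) 0 else 0)
      (monomialMat A n) = 0 := by
    split_ifs
    · rw [pairing_monomialMat, if_neg (by omega)]
    · simp [pairing]
  rw [loopDual, pairing_add_left, h0, add_zero, pairing_monomialMat]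
  exact if_congr (by omega) rfl rfl

lemma pairing_shiftElement (n : ℕ) (A : Matrix (Fin 3) (Fin 3) ℂ) :
    pairing shiftElement (monomialMat A n) = 0 := by
  rw [shiftElement, pairing_add_left, pairing_add_left, pairing_monomialMat, pairing_monomialMat,
    pairing_monomialMat, if_neg (by omega), if_neg (by omega), if_neg (by omega)]
  simp

/-- The dynamic variable `L_{a;n}`, extended by zero to `n ≥ N`. -/
def dynExt (L : DynVars N) (a : Fin 8) (n : ℕ) : ℂ := if h : n < N then L (a, ⟨n, h⟩) else 0

lemma dynExt_val (L : DynVars N) (a : Fin 8) (m : Fin N) : dynExt L a m = L (a, m) := by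
  simp [dynExt]

lemma dynExt_of_le (L : DynVars N) (a : Fin 8) {n : ℕ} (h : N ≤ n) : dynExt L a n = 0 := by
  simp [dynExt, h]

/-- The matrix `∑_c x_c X*_c`. -/
def dualMat (x : Fin 8 → ℂ) : Matrix (Fin 3) (Fin 3) ℂ := ∑ c, x c • slDual c

/-- The matrix `∑_a x_a X_a`. -/
def basisMat (x : Fin 8 → ℂ) : Matrix (Fin 3) (Fin 3) ℂ := ∑ a, x a • slBasis a

lemma pairing_laxMatrix (L : DynVars N) (n : ℕ) (A : Matrix (Fin 3) (Fin 3) ℂ) :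
    pairing (laxMatrix L) (monomialMat A n)
      = (dualMat (fun c => dynExt L c n) * A).trace := by
  rw [laxMatrix, pairing_add_left, pairing_shiftElement, zero_add, pairing_sum_left, dualMat,
    Finset.sum_mul, Matrix.trace_sum]
  simp only [pairing_sum_left, pairing_C_smul_left, pairing_loopDual, Matrix.smul_mul,
    Matrix.trace_smul, smul_eq_mul]
  rw [Finset.sum_comm]
  refine Finset.sum_congr rfl fun c _ => ?_
  by_cases h : n < N
  · rw [Finset.sum_eq_single ⟨n, h⟩]
    · simp [dynExt, h]
    · intro b _ hb
      rw [if_neg (fun hbn => hb (Fin.ext hbn)), mul_zero]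
    · simp
  · rw [dynExt_of_le _ _ (not_lt.1 h), zero_mul]
    exact Finset.sum_eq_zero fun b _ => by rw [if_neg (by omega), mul_zero]

lemma poissonTensor_eq (L : DynVars N) (p q : Fin 8 × Fin N) :
    poissonTensor L p q = (dualMat (fun c => dynExt L c ((p.2 : ℕ) + q.2)) *
      ⁅slBasis p.1, slBasis q.1⁆).trace := by
  rw [poissonTensor, loopBasis, loopBasis, monomialMat_lie, ← Nat.cast_add, pairing_laxMatrix]

/-- The Poisson tensor as a bilinear form on covectors. -/
def poissonForm (L : DynVars N) : DynVars N →ₗ[ℂ] DynVars N →ₗ[ℂ] ℂ :=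
  LinearMap.mk₂ ℂ (fun g h => ∑ p, ∑ q, poissonTensor L p q * g p * h q)
    (fun g g' h => by simp [mul_add, add_mul, Finset.sum_add_distrib])
    (fun c g h => by
      simp only [Pi.smul_apply, smul_eq_mul, Finset.mul_sum]
      exact Finset.sum_congr rfl fun _ _ => Finset.sum_congr rfl fun _ _ => by ring)
    (fun g h h' => by simp [mul_add, Finset.sum_add_distrib])
    (fun c g h => by
      simp only [Pi.smul_apply, smul_eq_mul, Finset.mul_sum]
      exact Finset.sum_congr rfl fun _ _ => Finset.sum_congr rfl fun _ _ => by ring)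

lemma poissonForm_apply (L g h : DynVars N) :
    poissonForm L g h = ∑ p, ∑ q, poissonTensor L p q * g p * h q := rfl

lemma liePoisson_eq (F H : DynVars N → ℂ) (L : DynVars N) :
    liePoisson F H L = poissonForm L (fun p => partialD F p L) (fun p => partialD H p L) := rfl

lemma poissonForm_swap (L g h : DynVars N) : poissonForm L g h = - poissonForm L h g := by
  rw [poissonForm_apply, poissonForm_apply, Finset.sum_comm, ← Finset.sum_neg_distrib]
  refine Finset.sum_congr rfl fun p _ => ?_
  rw [← Finset.sum_neg_distrib]
  refine Finset.sum_congr rfl fun q _ => ?_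
  rw [poissonTensor_eq, poissonTensor_eq, Ring.lie_def, Ring.lie_def, add_comm (q.2 : ℕ), mul_sub,
    mul_sub, Matrix.trace_sub, Matrix.trace_sub]
  ring

lemma poissonForm_self (L g : DynVars N) : poissonForm L g g = 0 :=
  self_eq_neg.1 (poissonForm_swap L g g)

/-- The covector `∑_a f_a d p_a(z)`, where `p_a` is the polynomial `dynPoly a`. -/
def evalCovector (f : Fin 8 → ℂ) (z : ℂ) : DynVars N := fun p => f p.1 * z ^ (N - 1 - (p.2 : ℕ))

/-- The covector `d β_{3;1}`. -/
def leadCovector [NeZero N] : DynVars N := Pi.single (4, 0) 1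

/-- The kernel `(z ^ N p_c(y) - y ^ N p_c(z)) / (z - y)` of the brackets `{p_a(z), p_b(y)}`. -/
def bracketKernel (L : DynVars N) (z y : ℂ) (c : Fin 8) : ℂ :=
  ∑ l : Fin N, ∑ m : Fin N,
    dynExt L c ((l : ℕ) + m) * z ^ (N - 1 - (l : ℕ)) * y ^ (N - 1 - (m : ℕ))

lemma dynPoly_eq_sum_range (L : DynVars N) (c : Fin 8) (z : ℂ) :
    dynPoly c L z = ∑ m ∈ Finset.range N, dynExt L c m * z ^ (N - 1 - m) := by
  rw [← Fin.sum_univ_eq_sum_range (fun m => dynExt L c m * z ^ (N - 1 - m)) N, dynPoly]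
  simp only [dynExt_val]

/-- Multiplying by z or by y shifts one summation index. The shifted double sums agree, since the
coefficients depend only on l + m, and the boundary terms survive. -/
lemma sub_mul_bracketKernel (L : DynVars N) (z y : ℂ) (c : Fin 8) :
    (z - y) * bracketKernel L z y c = z ^ N * dynPoly c L y - y ^ N * dynPoly c L z := by
  have key : ∀ (x t : ℂ), x * (∑ l ∈ Finset.range N, ∑ m ∈ Finset.range N,
        dynExt L c (l + m) * x ^ (N - 1 - l) * t ^ (N - 1 - m))
      = x ^ N * dynPoly c L t + ∑ l ∈ Finset.range N, ∑ m ∈ Finset.range N,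
        dynExt L c (l + m + 1) * x ^ (N - 1 - l) * t ^ (N - 1 - m) := by
    intro x t
    have h1 : x * (∑ l ∈ Finset.range N, ∑ m ∈ Finset.range N,
          dynExt L c (l + m) * x ^ (N - 1 - l) * t ^ (N - 1 - m))
        = ∑ l ∈ Finset.range (N + 1), ∑ m ∈ Finset.range N,
          dynExt L c (l + m) * x ^ (N - l) * t ^ (N - 1 - m) := by
      rw [Finset.sum_range_succ]
      -- The row l = N may be added because the variables are extended by zero; splitting off the
      -- row l = 0 instead then performs the shift.
      have h0 : ∑ m ∈ Finset.range N, dynExt L c (N + m) * x ^ (N - N) * t ^ (N - 1 - m) = 0 :=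
        Finset.sum_eq_zero fun m _ => by rw [dynExt_of_le _ _ (by omega)]; ring
      rw [h0, add_zero, Finset.mul_sum]
      refine Finset.sum_congr rfl fun l hl => ?_
      rw [Finset.mul_sum]
      refine Finset.sum_congr rfl fun m _ => ?_
      have : N - l = N - 1 - l + 1 := by have := Finset.mem_range.1 hl; omega
      rw [this, pow_succ]
      ring
    rw [h1, Finset.sum_range_succ', add_comm]
    congr 1
    · rw [dynPoly_eq_sum_range, Finset.mul_sum]
      refine Finset.sum_congr rfl fun m _ => ?_
      rw [zero_add, Nat.sub_zero]
      ring
    · refine Finset.sum_congr rfl fun l _ => Finset.sum_congr rfl fun m _ => ?_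
      rw [show l + 1 + m = l + m + 1 by ring, show N - (l + 1) = N - 1 - l by omega]
  have hk : bracketKernel L z y c = ∑ l ∈ Finset.range N, ∑ m ∈ Finset.range N,
        dynExt L c (l + m) * z ^ (N - 1 - l) * y ^ (N - 1 - m) := by
    rw [← Fin.sum_univ_eq_sum_range (fun l => ∑ m ∈ Finset.range N,
        dynExt L c (l + m) * z ^ (N - 1 - l) * y ^ (N - 1 - m)) N]
    exact Finset.sum_congr rfl fun l _ => Fin.sum_univ_eq_sum_range (fun m =>
        dynExt L c (l + m) * z ^ (N - 1 - (l : ℕ)) * y ^ (N - 1 - m)) N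
  have hsymm : ∀ n, (∑ l ∈ Finset.range N, ∑ m ∈ Finset.range N,
        dynExt L c (l + m + n) * z ^ (N - 1 - l) * y ^ (N - 1 - m))
      = ∑ l ∈ Finset.range N, ∑ m ∈ Finset.range N,
        dynExt L c (l + m + n) * y ^ (N - 1 - l) * z ^ (N - 1 - m) := by
    intro n
    rw [Finset.sum_comm]
    exact Finset.sum_congr rfl fun l _ => Finset.sum_congr rfl fun m _ => by
      rw [add_comm m l]; ring
  rw [sub_mul, hk, key z y]
  have h2 := hsymm 0
  simp only [add_zero] at h2
  rw [h2, key y z, hsymm 1]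
  ring

/-- The derivative of the polynomial `dynPoly a L`. -/
def dynPolyDeriv (a : Fin 8) (L : DynVars N) (z : ℂ) : ℂ :=
  ∑ m : Fin N, L (a, m) * (((N - 1 - (m : ℕ) : ℕ) : ℂ) * z ^ (N - 1 - (m : ℕ) - 1))

lemma hasDerivAt_dynPoly (a : Fin 8) (L : DynVars N) (z : ℂ) :
    HasDerivAt (dynPoly a L) (dynPolyDeriv a L z) z := by
  unfold dynPoly dynPolyDeriv
  exact HasDerivAt.fun_sum fun m _ => (hasDerivAt_pow _ z).const_mul _

/-- Differentiate `sub_mul_bracketKernel` in y at y = z; the factor z - y removes the derivative of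
the kernel. -/
lemma bracketKernel_self (L : DynVars N) (z : ℂ) (c : Fin 8) :
    bracketKernel L z z c
      = N * z ^ (N - 1) * dynPoly c L z - z ^ N * dynPolyDeriv c L z := by
  have hd : DifferentiableAt ℂ (fun y => bracketKernel L z y c) z := by
    unfold bracketKernel
    fun_prop
  have h1 := ((hasDerivAt_id z).const_sub z).mul hd.hasDerivAt
  have h2 := ((hasDerivAt_dynPoly c L z).const_mul (z ^ N)).sub
    ((hasDerivAt_pow N z).mul_const (dynPoly c L z))
  have h3 := h1.unique (h2.congr_of_eventuallyEq
    (Filter.Eventually.of_forall fun y => sub_mul_bracketKernel L z y c))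
  simp only [id, sub_self, zero_mul, add_zero] at h3
  linear_combination -h3

/-- The tensor entry at levels l, m sees the dynamic variables only at level l + m, so summing over
levels packs them into the kernel and leaves a finite-dimensional trace. -/
lemma poissonForm_evalCovector (L : DynVars N) (f g : Fin 8 → ℂ) (z y : ℂ) :
    poissonForm L (evalCovector f z) (evalCovector g y)
      = (dualMat (bracketKernel L z y) * ⁅basisMat f, basisMat g⁆).trace := by
  have h : ⁅basisMat f, basisMat g⁆ = ∑ a, ∑ b, (f a * g b) • ⁅slBasis a, slBasis b⁆ := by
    simp only [basisMat, Ring.lie_def, Finset.sum_mul_sum, smul_sub, Finset.sum_sub_distrib,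
      smul_mul_smul_comm]
    congr 1
    rw [Finset.sum_comm]
    simp only [mul_comm]
  have h2 : dualMat (bracketKernel L z y) = ∑ l : Fin N, ∑ m : Fin N,
      (z ^ (N - 1 - (l : ℕ)) * y ^ (N - 1 - (m : ℕ))) •
        dualMat (fun c => dynExt L c ((l : ℕ) + m)) := by
    simp only [dualMat, bracketKernel, Finset.smul_sum, Finset.sum_smul, smul_smul]
    rw [Finset.sum_comm]
    refine Finset.sum_congr rfl fun l _ => ?_
    rw [Finset.sum_comm]
    exact Finset.sum_congr rfl fun m _ => Finset.sum_congr rfl fun c _ => by congr 1; ring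
  rw [h, h2, poissonForm_apply]
  simp only [Finset.sum_mul, Finset.mul_sum, Matrix.trace_sum, Fintype.sum_prod_type,
    Matrix.smul_mul, Matrix.mul_smul, Matrix.trace_smul, smul_eq_mul, poissonTensor_eq,
    evalCovector]
  refine Finset.sum_congr rfl fun a _ => ?_
  rw [Finset.sum_comm]
  exact Finset.sum_congr rfl fun b _ => Finset.sum_congr rfl fun l _ =>
    Finset.sum_congr rfl fun m _ => by ring

/-- Only level 0 of `slBasis 4`, which is `E 2 0`, occurs on the left, so a single sum over levels
remains and the kernel becomes `dynPoly`. -/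
lemma poissonForm_leadCovector [NeZero N] (L : DynVars N) (g : Fin 8 → ℂ) (y : ℂ) :
    poissonForm L leadCovector (evalCovector g y)
      = (dualMat (fun c => dynPoly c L y) * ⁅E 2 0, basisMat g⁆).trace := by
  have h : ⁅E 2 0, basisMat g⁆ = ∑ b, g b • ⁅slBasis 4, slBasis b⁆ := by
    simp only [basisMat, Ring.lie_def, Finset.mul_sum, Finset.sum_mul, smul_sub,
      Finset.sum_sub_distrib, Matrix.mul_smul, Matrix.smul_mul]
    rfl
  have h2 : dualMat (fun c => dynPoly c L y) = ∑ m : Fin N,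
      y ^ (N - 1 - (m : ℕ)) • dualMat (fun c => dynExt L c m) := by
    simp only [dualMat, dynPoly, Finset.smul_sum, Finset.sum_smul, smul_smul, dynExt_val]
    rw [Finset.sum_comm]
    exact Finset.sum_congr rfl fun m _ => Finset.sum_congr rfl fun c _ => by rw [mul_comm]
  rw [h, h2, poissonForm_apply, Finset.sum_eq_single (4, 0)]
  · simp only [Finset.sum_mul, Finset.mul_sum, Matrix.trace_sum, Fintype.sum_prod_type,
      Matrix.smul_mul, Matrix.mul_smul, Matrix.trace_smul, smul_eq_mul, poissonTensor_eq,
      evalCovector, leadCovector, Pi.single_eq_same, Fin.val_zero, zero_add]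
    exact Finset.sum_congr rfl fun b _ => Finset.sum_congr rfl fun m _ => by ring
  · intro p _ hp
    simp [leadCovector, Pi.single_eq_of_ne hp]
  · simp

lemma dualMat_eq (x : Fin 8 → ℂ) :
    dualMat x = !![x 0, x 2, x 4; x 5, x 1 - x 0, x 3; x 7, x 6, -x 1] := by
  ext i j
  fin_cases i <;> fin_cases j
  all_goals simp [dualMat, slDual, E, Fin.sum_univ_eight, Matrix.add_apply]
  all_goals ring

lemma basisMat_eq (f₀ f₁ f₂ f₃ f₄ f₅ : ℂ) :
    basisMat ![f₀, f₁, f₂, f₃, f₄, f₅, 0, 0]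
      = !![(2 * f₀ + f₁) / 3, f₅, 0; f₂, (f₁ - f₀) / 3, 0; f₄, f₃, -(f₀ + 2 * f₁) / 3] := by
  ext i j
  fin_cases i <;> fin_cases j
  all_goals simp [basisMat, slBasis, E, Fin.sum_univ_eight, Matrix.add_apply]
  all_goals ring

lemma E_two_zero : E 2 0 = !![0, 0, 0; 0, 0, 0; 1, 0, 0] := by
  ext i j
  fin_cases i <;> fin_cases j <;> simp [E]

/-- Both minors avoid the last two basis directions. The other six span a subalgebra, so `Q 6` and
`Q 7` drop out. -/
lemma trace_dualMat_mul_lie (Q : Fin 8 → ℂ) (f₀ f₁ f₂ f₃ f₄ f₅ g₀ g₁ g₂ g₃ g₄ g₅ : ℂ) :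
    (dualMat Q * ⁅basisMat ![f₀, f₁, f₂, f₃, f₄, f₅, 0, 0],
        basisMat ![g₀, g₁, g₂, g₃, g₄, g₅, 0, 0]⁆).trace
      = (Q 1 - 2 * Q 0) * (f₂ * g₅ - f₅ * g₂) + Q 2 * (f₂ * g₀ - f₀ * g₂)
        + Q 3 * (f₃ * g₁ - f₁ * g₃ + f₄ * g₅ - f₅ * g₄)
        + Q 4 * (f₄ * (g₀ + g₁) - (f₀ + f₁) * g₄ + f₃ * g₂ - f₂ * g₃)
        + Q 5 * (f₀ * g₅ - f₅ * g₀) := by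
  rw [dualMat_eq, basisMat_eq, basisMat_eq, Ring.lie_def]
  simp [Matrix.trace_fin_three]
  ring

lemma trace_dualMat_mul_lie_E (Q : Fin 8 → ℂ) (g₀ g₁ g₂ g₃ g₄ g₅ : ℂ) :
    (dualMat Q * ⁅E 2 0, basisMat ![g₀, g₁, g₂, g₃, g₄, g₅, 0, 0]⁆).trace
      = Q 3 * g₅ + Q 4 * (g₀ + g₁) := by
  rw [dualMat_eq, basisMat_eq, E_two_zero, Ring.lie_def]
  simp [Matrix.trace_fin_three]
  ring

end Boussinesq

/-! ### Brackets of the two minors -/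

namespace Boussinesq

variable {N : ℕ} [NeZero N]

/-- The `(1,1)` entry of the matrix `z ^ N L_N(z) - w`. -/
def entry₁₁ (L : DynVars N) (z w : ℂ) : ℂ := α₁ L z - w
/-- The `(1,2)` entry of the matrix `z ^ N L_N(z) - w`. -/
def entry₁₂ (L : DynVars N) (z : ℂ) : ℂ := z ^ N + β₁ L z
/-- The `(2,1)` entry of the matrix `z ^ N L_N(z) - w`. -/
def entry₂₁ (L : DynVars N) (z : ℂ) : ℂ := β₃₁ L * z ^ N + γ₁ L z
/-- The `(2,2)` entry of the matrix `z ^ N L_N(z) - w`. -/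
def entry₂₂ (L : DynVars N) (z w : ℂ) : ℂ := α₂ L z - α₁ L z - w
/-- The `(2,3)` entry of the matrix `z ^ N L_N(z) - w`. -/
def entry₂₃ (L : DynVars N) (z : ℂ) : ℂ := z ^ N + β₂ L z

/-- The first function of the system that defines the divisor, as a minor of `z ^ N L_N(z) - w`. -/
def minor₁ (L : DynVars N) (z w : ℂ) : ℂ :=
  β₃ L z * entry₂₁ L z - entry₁₁ L z w * entry₂₃ L z
/-- The second function of the system that defines the divisor, as a minor of `z ^ N L_N(z) - w`. -/
def minor₂ (L : DynVars N) (z w : ℂ) : ℂ :=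
  entry₁₂ L z * entry₂₃ L z - β₃ L z * entry₂₂ L z w

lemma mem_divisorZeros_iff (L : DynVars N) (P : ℂ × ℂ) :
    P ∈ divisorZeros L ↔ minor₁ L P.1 P.2 = 0 ∧ minor₂ L P.1 P.2 = 0 := by
  have h1 : P.2 * (P.1 ^ N + β₂ L P.1) + B₂ L P.1 = minor₁ L P.1 P.2 := by
    rw [B₂, Matrix.det_fin_two_of, minor₁, entry₂₁, entry₁₁, entry₂₃]
    ring
  have h2 : P.2 * β₃ L P.1 + (P.1 ^ (2 * N) + B₃ L P.1) = minor₂ L P.1 P.2 := by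
    rw [B₃, Matrix.det_fin_two_of, minor₂, entry₁₂, entry₂₂, entry₂₃]
    ring
  rw [divisorZeros, Set.mem_ofPred_eq, h1, h2]

/-- The differential of `minor₁` in the dynamic variables. -/
def covector₁ (L : DynVars N) (z w : ℂ) : DynVars N :=
  evalCovector ![-entry₂₃ L z, 0, 0, -entry₁₁ L z w, entry₂₁ L z, β₃ L z, 0, 0] z
    + (β₃ L z * z ^ N) • leadCovector

/-- The differential of `minor₂` in the dynamic variables. -/
def covector₂ (L : DynVars N) (z w : ℂ) : DynVars N :=
  evalCovector ![β₃ L z, -β₃ L z, entry₂₃ L z, entry₁₂ L z, -entry₂₂ L z w, 0, 0, 0] z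

/-- The derivative of `minor₁` in the variable `z`. -/
def zDeriv₁ (L : DynVars N) (z w : ℂ) : ℂ :=
  dynPolyDeriv 4 L z * entry₂₁ L z
    + β₃ L z * (β₃₁ L * (N * z ^ (N - 1)) + dynPolyDeriv 5 L z)
    - dynPolyDeriv 0 L z * entry₂₃ L z
    - entry₁₁ L z w * (N * z ^ (N - 1) + dynPolyDeriv 3 L z)

/-- The derivative of `minor₂` in the variable `z`. -/
def zDeriv₂ (L : DynVars N) (z w : ℂ) : ℂ :=
  (N * z ^ (N - 1) + dynPolyDeriv 2 L z) * entry₂₃ L z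
    + entry₁₂ L z * (N * z ^ (N - 1) + dynPolyDeriv 3 L z)
    - dynPolyDeriv 4 L z * entry₂₂ L z w
    - β₃ L z * (dynPolyDeriv 1 L z - dynPolyDeriv 0 L z)

/-- The Jacobian determinant of `(minor₁, minor₂)` in the variables `(z, w)`. -/
def jacobian (L : DynVars N) (z w : ℂ) : ℂ :=
  zDeriv₁ L z w * β₃ L z - entry₂₃ L z * zDeriv₂ L z w

section Brackets

variable (L : DynVars N) (z y w v : ℂ)

lemma poissonForm_covector₁ :
    (z - y) * poissonForm L (covector₁ L z w) (covector₁ L y v) = 0 := by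
  have h3 := sub_mul_bracketKernel L z y 3
  have h4 := sub_mul_bracketKernel L z y 4
  have h5 := sub_mul_bracketKernel L z y 5
  simp only [covector₁, map_add, map_smul, LinearMap.add_apply, LinearMap.smul_apply, smul_eq_mul,
    poissonForm_self, poissonForm_leadCovector, poissonForm_evalCovector,
    poissonForm_swap L (evalCovector _ z) leadCovector, trace_dualMat_mul_lie,
    trace_dualMat_mul_lie_E]
  simp only [entry₁₁, entry₂₁, entry₂₃, α₁, β₂, β₃, γ₁] at *
  -- The multipliers are the coefficients of the kernels in `trace_dualMat_mul_lie`.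
  linear_combination
    ((β₃₁ L * z ^ N + dynPoly 5 L z) * dynPoly 4 L y
      - dynPoly 4 L z * (β₃₁ L * y ^ N + dynPoly 5 L y)) * h3
    + (-(β₃₁ L * z ^ N + dynPoly 5 L z) * (y ^ N + dynPoly 3 L y)
      + (z ^ N + dynPoly 3 L z) * (β₃₁ L * y ^ N + dynPoly 5 L y)) * h4
    + (-(z ^ N + dynPoly 3 L z) * dynPoly 4 L y + dynPoly 4 L z * (y ^ N + dynPoly 3 L y)) * h5

omit [NeZero N] in
lemma poissonForm_covector₂ :
    (z - y) * poissonForm L (covector₂ L z w) (covector₂ L y v) = 0 := by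
  have h2 := sub_mul_bracketKernel L z y 2
  have h3 := sub_mul_bracketKernel L z y 3
  have h4 := sub_mul_bracketKernel L z y 4
  simp only [covector₂, poissonForm_evalCovector, trace_dualMat_mul_lie]
  simp only [entry₁₂, entry₂₂, entry₂₃, β₁, β₂, β₃] at *
  linear_combination
    ((z ^ N + dynPoly 3 L z) * dynPoly 4 L y - dynPoly 4 L z * (y ^ N + dynPoly 3 L y)) * h2
    + (-(z ^ N + dynPoly 2 L z) * dynPoly 4 L y + dynPoly 4 L z * (y ^ N + dynPoly 2 L y)) * h3
    + ((z ^ N + dynPoly 2 L z) * (y ^ N + dynPoly 3 L y)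
      - (z ^ N + dynPoly 3 L z) * (y ^ N + dynPoly 2 L y)) * h4

/-- Each term on the right contains a minor at one of the two points, so the bracket vanishes when
both points are zeros and z ≠ y. -/
lemma poissonForm_covector₁_covector₂ :
    (z - y) * poissonForm L (covector₁ L z w) (covector₂ L y v)
      = z ^ N * (entry₂₃ L z * minor₂ L y v - β₃ L z * minor₁ L y v)
        - y ^ N * (entry₂₃ L y * minor₂ L z w - β₃ L y * minor₁ L z w) := by
  have h0 := sub_mul_bracketKernel L z y 0
  have h1 := sub_mul_bracketKernel L z y 1
  have h2 := sub_mul_bracketKernel L z y 2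
  have h3 := sub_mul_bracketKernel L z y 3
  have h4 := sub_mul_bracketKernel L z y 4
  have h5 := sub_mul_bracketKernel L z y 5
  simp only [covector₁, covector₂, map_add, map_smul, LinearMap.add_apply, LinearMap.smul_apply,
    smul_eq_mul, poissonForm_leadCovector, poissonForm_evalCovector, trace_dualMat_mul_lie,
    trace_dualMat_mul_lie_E]
  simp only [minor₁, minor₂, entry₁₁, entry₁₂, entry₂₁, entry₂₂, entry₂₃, α₁, α₂, β₁, β₂, β₃,
    γ₁] at *
  linear_combination
    -dynPoly 4 L z * (y ^ N + dynPoly 3 L y) * (h1 - 2 * h0)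
    + (z ^ N + dynPoly 3 L z) * (y ^ N + dynPoly 3 L y) * h2
    + ((dynPoly 0 L z - w) * dynPoly 4 L y
      + dynPoly 4 L z * (dynPoly 1 L y - dynPoly 0 L y - v)) * h3
    - ((z ^ N + dynPoly 3 L z) * (dynPoly 1 L y - dynPoly 0 L y - v)
      + (dynPoly 0 L z - w) * (y ^ N + dynPoly 3 L y)) * h4
    - dynPoly 4 L z * dynPoly 4 L y * h5

variable {L z w} in
-- The confluent case, where z - y cannot be cancelled: `bracketKernel_self` brings in
-- z-derivatives, which assemble into the Jacobian modulo the two minors.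
lemma poissonForm_covector_self (hz : minor₁ L z w = 0) (hw : minor₂ L z w = 0) :
    poissonForm L (covector₁ L z w) (covector₂ L z w) = z ^ N * jacobian L z w := by
  simp only [covector₁, covector₂, map_add, map_smul, LinearMap.add_apply, LinearMap.smul_apply,
    smul_eq_mul, poissonForm_leadCovector, poissonForm_evalCovector, trace_dualMat_mul_lie,
    trace_dualMat_mul_lie_E, bracketKernel_self]
  simp only [jacobian, zDeriv₁, zDeriv₂, minor₁, minor₂, entry₁₁, entry₁₂, entry₂₁, entry₂₂,
    entry₂₃, α₁, α₂, β₁, β₂, β₃, γ₁] at *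
  linear_combination
    (N * z ^ (N - 1)) * ((z ^ N + dynPoly 3 L z) * hw - dynPoly 4 L z * hz)
    + z ^ N * ((N * z ^ (N - 1) + dynPolyDeriv 3 L z) * hw - dynPolyDeriv 4 L z * hz)

end Brackets

end Boussinesq

/-! ### Derivatives of the minors and the implicit function theorem -/

namespace Boussinesq

open Filter Topology

variable {N : ℕ}

lemma sum_evalCovector_mul (f : Fin 8 → ℂ) (z : ℂ) (x : DynVars N) :
    ∑ p, evalCovector f z p * x p = ∑ a, f a * dynPoly a x z := by
  simp only [Fintype.sum_prod_type, evalCovector, dynPoly, Finset.mul_sum]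
  exact Finset.sum_congr rfl fun a _ => Finset.sum_congr rfl fun m _ => by ring

lemma sum_leadCovector_mul [NeZero N] (x : DynVars N) :
    ∑ p, leadCovector p * x p = β₃₁ x := by
  rw [Finset.sum_eq_single (4, 0)]
  · simp [leadCovector, β₃₁]
  · intro p _ hp
    simp [leadCovector, Pi.single_eq_of_ne hp]
  · simp

lemma exists_hasStrictFDerivAt_dynPoly (a : Fin 8) (L : DynVars N) (z w : ℂ) :
    ∃ D : DynVars N × ℂ × ℂ →L[ℂ] ℂ,
      HasStrictFDerivAt (fun u : DynVars N × ℂ × ℂ => dynPoly a u.1 u.2.1) D (L, z, w) ∧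
      ∀ x s t, D (x, s, t) = dynPoly a x z + dynPolyDeriv a L z * s := by
  have hz : HasStrictFDerivAt (fun u : DynVars N × ℂ × ℂ => u.2.1)
      ((ContinuousLinearMap.fst ℂ ℂ ℂ).comp (ContinuousLinearMap.snd ℂ (DynVars N) (ℂ × ℂ)))
      (L, z, w) := ((ContinuousLinearMap.fst ℂ ℂ ℂ).comp
        (ContinuousLinearMap.snd ℂ (DynVars N) (ℂ × ℂ))).hasStrictFDerivAt
  have hL : ∀ m : Fin N, HasStrictFDerivAt (fun u : DynVars N × ℂ × ℂ => u.1 (a, m))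
      ((ContinuousLinearMap.proj (R := ℂ) (φ := fun _ : Fin 8 × Fin N => ℂ) (a, m)).comp
        (ContinuousLinearMap.fst ℂ (DynVars N) (ℂ × ℂ))) (L, z, w) :=
    fun m => ((ContinuousLinearMap.proj (R := ℂ) (φ := fun _ : Fin 8 × Fin N => ℂ) (a, m)).comp
      (ContinuousLinearMap.fst ℂ (DynVars N) (ℂ × ℂ))).hasStrictFDerivAt
  refine ⟨_, HasStrictFDerivAt.fun_sum fun m _ => (hL m).mul (hz.pow (N - 1 - (m : ℕ))), ?_⟩
  intro x s t
  simp only [sum_apply, add_apply,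
    smul_apply, ContinuousLinearMap.comp_apply, dynPoly, dynPolyDeriv,
    Finset.sum_mul, ← Finset.sum_add_distrib]
  refine Finset.sum_congr rfl fun m _ => ?_
  simp
  ring

variable [NeZero N]

section Derivatives

variable (L : DynVars N) (z w : ℂ)

/-- Confirms that the covectors and `zDeriv₁`, `zDeriv₂` defined by formulas are the actual partial
derivatives; those in w are `entry₂₃` and `β₃`. -/
lemma hasStrictFDerivAt_minors :
    ∃ D₁ D₂ : DynVars N × ℂ × ℂ →L[ℂ] ℂ,
      (HasStrictFDerivAt (fun u : DynVars N × ℂ × ℂ => minor₁ u.1 u.2.1 u.2.2) D₁ (L, z, w) ∧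
      ∀ x s t, D₁ (x, s, t)
        = ∑ p, covector₁ L z w p * x p + zDeriv₁ L z w * s + entry₂₃ L z * t) ∧
      (HasStrictFDerivAt (fun u : DynVars N × ℂ × ℂ => minor₂ u.1 u.2.1 u.2.2) D₂ (L, z, w) ∧
      ∀ x s t, D₂ (x, s, t)
        = ∑ p, covector₂ L z w p * x p + zDeriv₂ L z w * s + β₃ L z * t) := by
  have hz : HasStrictFDerivAt (fun u : DynVars N × ℂ × ℂ => u.2.1)
      ((ContinuousLinearMap.fst ℂ ℂ ℂ).comp (ContinuousLinearMap.snd ℂ (DynVars N) (ℂ × ℂ)))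
      (L, z, w) := ((ContinuousLinearMap.fst ℂ ℂ ℂ).comp
        (ContinuousLinearMap.snd ℂ (DynVars N) (ℂ × ℂ))).hasStrictFDerivAt
  have hw : HasStrictFDerivAt (fun u : DynVars N × ℂ × ℂ => u.2.2)
      ((ContinuousLinearMap.snd ℂ ℂ ℂ).comp (ContinuousLinearMap.snd ℂ (DynVars N) (ℂ × ℂ)))
      (L, z, w) := ((ContinuousLinearMap.snd ℂ ℂ ℂ).comp
        (ContinuousLinearMap.snd ℂ (DynVars N) (ℂ × ℂ))).hasStrictFDerivAt
  have hb : HasStrictFDerivAt (fun u : DynVars N × ℂ × ℂ => u.1 (4, 0))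
      ((ContinuousLinearMap.proj (R := ℂ) (φ := fun _ : Fin 8 × Fin N => ℂ) (4, 0)).comp
        (ContinuousLinearMap.fst ℂ (DynVars N) (ℂ × ℂ))) (L, z, w) :=
    ((ContinuousLinearMap.proj (R := ℂ) (φ := fun _ : Fin 8 × Fin N => ℂ) (4, 0)).comp
      (ContinuousLinearMap.fst ℂ (DynVars N) (ℂ × ℂ))).hasStrictFDerivAt
  obtain ⟨E0, h0, h0'⟩ := exists_hasStrictFDerivAt_dynPoly 0 L z w
  obtain ⟨E1, h1, h1'⟩ := exists_hasStrictFDerivAt_dynPoly 1 L z w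
  obtain ⟨E2, h2, h2'⟩ := exists_hasStrictFDerivAt_dynPoly 2 L z w
  obtain ⟨E3, h3, h3'⟩ := exists_hasStrictFDerivAt_dynPoly 3 L z w
  obtain ⟨E4, h4, h4'⟩ := exists_hasStrictFDerivAt_dynPoly 4 L z w
  obtain ⟨E5, h5, h5'⟩ := exists_hasStrictFDerivAt_dynPoly 5 L z w
  refine ⟨_, _, ⟨(h4.mul ((hb.mul (hz.pow N)).add h5)).sub ((h0.sub hw).mul ((hz.pow N).add h3)),
    ?_⟩, ⟨(((hz.pow N).add h2).mul ((hz.pow N).add h3)).sub (h4.mul ((h1.sub h0).sub hw)), ?_⟩⟩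
  · intro x s t
    simp only [covector₁, Pi.add_apply, Pi.smul_apply, add_mul, Finset.sum_add_distrib,
      smul_eq_mul, mul_assoc, ← Finset.mul_sum, sum_evalCovector_mul, sum_leadCovector_mul]
    simp [h0', h3', h4', h5', Fin.sum_univ_eight, zDeriv₁, entry₁₁, entry₂₁, entry₂₃, α₁, β₂, β₃,
      γ₁, β₃₁]
    ring
  · intro x s t
    simp only [covector₂, sum_evalCovector_mul]
    simp [h0', h1', h2', h3', h4', Fin.sum_univ_eight, zDeriv₂, entry₁₂, entry₂₂, entry₂₃, α₁, α₂,
      β₁, β₂, β₃]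
    ring

variable {L z w}

/-- Near a zero with nonvanishing Jacobian, the common zeros of the two minors form the graph of a
strictly differentiable function of the dynamic variables. -/
lemma exists_implicitFunction (hzero : (z, w) ∈ divisorZeros L) (hJ : jacobian L z w ≠ 0) :
    ∃ (ψ : DynVars N → ℂ × ℂ) (ψ' : DynVars N →L[ℂ] ℂ × ℂ), HasStrictFDerivAt ψ ψ' L ∧
      ψ L = (z, w) ∧ ∀ᶠ u : DynVars N × ℂ × ℂ in 𝓝 (L, z, w),
        (u.2 ∈ divisorZeros u.1 ↔ ψ u.1 = u.2) := by
  obtain ⟨D₁, D₂, ⟨h₁, h₁'⟩, ⟨h₂, h₂'⟩⟩ := hasStrictFDerivAt_minors L z w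
  have hΦ := h₁.prodMk h₂
  have hinv : ((D₁.prod D₂) ∘L .inr ℂ (DynVars N) (ℂ × ℂ)).IsInvertible := by
    have hinj : Function.Injective
        (((D₁.prod D₂) ∘L .inr ℂ (DynVars N) (ℂ × ℂ) : ℂ × ℂ →L[ℂ] ℂ × ℂ) :
          ℂ × ℂ →ₗ[ℂ] ℂ × ℂ) := by
      rw [← LinearMap.ker_eq_bot, LinearMap.ker_eq_bot']
      rintro ⟨s, t⟩ hst
      have e₁ := congrArg Prod.fst hst
      have e₂ := congrArg Prod.snd hst
      simp [h₁', h₂'] at e₁ e₂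
      -- Cramer's rule for the 2 × 2 system in (s, t).
      have hs : jacobian L z w * s = 0 := by
        rw [jacobian]; linear_combination β₃ L z * e₁ - entry₂₃ L z * e₂
      have ht : jacobian L z w * t = 0 := by
        rw [jacobian]; linear_combination zDeriv₁ L z w * e₂ - zDeriv₂ L z w * e₁
      rw [(mul_eq_zero.1 hs).resolve_left hJ, (mul_eq_zero.1 ht).resolve_left hJ]
      rfl
    exact ⟨(LinearEquiv.ofInjectiveEndo _ hinj).toContinuousLinearEquiv, by ext <;> rfl⟩
  have hz := (mem_divisorZeros_iff L (z, w)).1 hzero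
  have hev := hΦ.eventually_apply_eq_iff_implicitFunctionOfProdDomain hinv
  refine ⟨hΦ.implicitFunctionOfProdDomain hinv, _,
    hΦ.hasStrictFDerivAt_implicitFunctionOfProdDomain hinv, hev.self_of_nhds.1 rfl, ?_⟩
  filter_upwards [hev] with u hu
  rw [← hu, mem_divisorZeros_iff, Prod.mk.injEq, hz.1, hz.2]

/-- Implicit differentiation of the equations satisfied by the divisor coordinates. -/
lemma covector_eq_of_eventually {f g : DynVars N → ℂ} (hf : DifferentiableAt ℂ f L)
    (hg : DifferentiableAt ℂ g L) (h : ∀ᶠ x in 𝓝 L, (f x, g x) ∈ divisorZeros x) :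
    covector₁ L (f L) (g L) + zDeriv₁ L (f L) (g L) • (fun p => partialD f p L)
        + entry₂₃ L (f L) • (fun p => partialD g p L) = 0 ∧
    covector₂ L (f L) (g L) + zDeriv₂ L (f L) (g L) • (fun p => partialD f p L)
        + β₃ L (f L) • (fun p => partialD g p L) = 0 := by
  obtain ⟨D₁, D₂, ⟨h₁, h₁'⟩, ⟨h₂, h₂'⟩⟩ := hasStrictFDerivAt_minors L (f L) (g L)
  have hγ : HasFDerivAt (fun x => (x, f x, g x))
      ((ContinuousLinearMap.id ℂ (DynVars N)).prod ((fderiv ℂ f L).prod (fderiv ℂ g L))) L :=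
    (hasFDerivAt_id L).prodMk (hf.hasFDerivAt.prodMk hg.hasFDerivAt)
  have k₁ := h₁.hasFDerivAt.comp L hγ
  have k₂ := h₂.hasFDerivAt.comp L hγ
  have z₁ := k₁.unique ((hasFDerivAt_const (0 : ℂ) L).congr_of_eventuallyEq
    (h.mono fun x hx => ((mem_divisorZeros_iff x _).1 hx).1))
  have z₂ := k₂.unique ((hasFDerivAt_const (0 : ℂ) L).congr_of_eventuallyEq
    (h.mono fun x hx => ((mem_divisorZeros_iff x _).1 hx).2))
  constructor <;> ext p
  · simpa [h₁', partialD, Pi.single_apply] using DFunLike.congr_fun z₁ (Pi.single p 1)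
  · simpa [h₂', partialD, Pi.single_apply] using DFunLike.congr_fun z₂ (Pi.single p 1)

end Derivatives

end Boussinesq

/-! ### Elimination of w and the count of zeros -/

namespace Boussinesq

open Polynomial in
/-- The polynomial whose values are given by `dynPoly`. -/
def dynPolynomial {N : ℕ} (a : Fin 8) (L : DynVars N) : ℂ[X] :=
  ∑ m : Fin N, C (L (a, m)) * X ^ (N - 1 - (m : ℕ))

variable {N : ℕ}

lemma eval_dynPolynomial (a : Fin 8) (L : DynVars N) (z : ℂ) :
    (dynPolynomial a L).eval z = dynPoly a L z := by
  simp [dynPolynomial, dynPoly, Polynomial.eval_finsetSum]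

lemma eval_derivative_dynPolynomial (a : Fin 8) (L : DynVars N) (z : ℂ) :
    (dynPolynomial a L).derivative.eval z = dynPolyDeriv a L z := by
  have h : (fun y => (dynPolynomial a L).eval y) = dynPoly a L :=
    funext fun y => eval_dynPolynomial a L y
  exact ((dynPolynomial a L).hasDerivAt z).unique (h ▸ hasDerivAt_dynPoly a L z)

open Polynomial in
lemma natDegree_dynPolynomial_le (a : Fin 8) (L : DynVars N) :
    (dynPolynomial a L).natDegree ≤ N - 1 :=
  natDegree_sum_le_of_forall_le _ _ fun m _ =>
    (natDegree_C_mul_X_pow_le _ _).trans (by omega)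

section Resultant

open Polynomial

variable [NeZero N] (L : DynVars N)

/-- The resultant in `w` of the two equations of the divisor. -/
def resultantPoly : ℂ[X] :=
  (X ^ N + dynPolynomial 3 L) * (X ^ N + dynPolynomial 3 L) * (X ^ N + dynPolynomial 2 L)
    + (dynPolynomial 0 L * (X ^ N + dynPolynomial 3 L) * dynPolynomial 4 L
      - (X ^ N + dynPolynomial 3 L) * dynPolynomial 4 L * (dynPolynomial 1 L - dynPolynomial 0 L)
      - dynPolynomial 4 L * dynPolynomial 4 L * (C (β₃₁ L) * X ^ N + dynPolynomial 5 L))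

lemma eval_resultantPoly (z w : ℂ) :
    (resultantPoly L).eval z = entry₂₃ L z * minor₂ L z w - β₃ L z * minor₁ L z w := by
  simp only [resultantPoly, eval_add, eval_sub, eval_mul, eval_pow, eval_X, eval_C,
    eval_dynPolynomial, minor₁, minor₂, entry₁₁, entry₁₂, entry₂₁, entry₂₂, entry₂₃, α₁, α₂, β₁,
    β₂, β₃, γ₁]
  ring

variable {L} in
-- In the derivative of `entry₂₃ * minor₂ - β₃ * minor₁` the terms that keep a minor
-- undifferentiated vanish at a zero; what is left is minus the Jacobian.
lemma eval_derivative_resultantPoly {z w : ℂ} (h : (z, w) ∈ divisorZeros L) :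
    (resultantPoly L).derivative.eval z = -jacobian L z w := by
  obtain ⟨h₁, h₂⟩ := (mem_divisorZeros_iff L (z, w)).1 h
  simp only [minor₁, minor₂, entry₁₁, entry₁₂, entry₂₁, entry₂₂, entry₂₃, α₁, α₂, β₁, β₂, β₃,
    γ₁] at h₁ h₂
  simp only [resultantPoly, derivative_add, derivative_sub, derivative_mul, derivative_X_pow,
    derivative_C, eval_add, eval_sub, eval_mul, eval_pow, eval_X, eval_C, eval_zero,
    eval_dynPolynomial, eval_derivative_dynPolynomial, jacobian, zDeriv₁, zDeriv₂, entry₁₁,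
    entry₁₂, entry₂₁, entry₂₂, entry₂₃, α₁, α₂, β₁, β₂, β₃, γ₁]
  linear_combination (N * z ^ (N - 1) + dynPolyDeriv 3 L z) * h₂ - dynPolyDeriv 4 L z * h₁

lemma monic_resultantPoly : (resultantPoly L).Monic ∧ (resultantPoly L).natDegree = 3 * N := by
  have hN : 0 < N := NeZero.pos N
  have hd := fun a => natDegree_dynPolynomial_le a L
  have hlt : ∀ a, (dynPolynomial a L).degree < N := fun a =>
    lt_of_le_of_lt (degree_le_of_natDegree_le (hd a)) (by exact_mod_cast (by omega))
  have hm := fun a => monic_X_pow_add (hlt a)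
  have hn : ∀ a, (X ^ N + dynPolynomial a L).natDegree = N := fun a => by
    rw [natDegree_add_eq_left_of_degree_lt, natDegree_X_pow]
    rw [degree_X_pow]; exact hlt a
  have hG : (C (β₃₁ L) * X ^ N + dynPolynomial 5 L).natDegree ≤ N :=
    natDegree_add_le_of_degree_le (natDegree_C_mul_X_pow_le _ _) ((hd 5).trans (by omega))
  have hH : (dynPolynomial 1 L - dynPolynomial 0 L).natDegree ≤ N - 1 :=
    (natDegree_sub_le_of_le (hd 1) (hd 0)).trans (by simp)
  have hlead := ((hm 3).mul (hm 3)).mul (hm 2)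
  have hdeg : ((X ^ N + dynPolynomial 3 L) * (X ^ N + dynPolynomial 3 L)
      * (X ^ N + dynPolynomial 2 L)).natDegree = 3 * N := by
    rw [((hm 3).mul (hm 3)).natDegree_mul (hm 2), (hm 3).natDegree_mul (hm 3), hn, hn]
    ring
  -- Each product has one factor of degree at most N and two of degree at most N - 1.
  have hrest : (dynPolynomial 0 L * (X ^ N + dynPolynomial 3 L) * dynPolynomial 4 L
      - (X ^ N + dynPolynomial 3 L) * dynPolynomial 4 L * (dynPolynomial 1 L - dynPolynomial 0 L)
      - dynPolynomial 4 L * dynPolynomial 4 L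
        * (C (β₃₁ L) * X ^ N + dynPolynomial 5 L)).natDegree ≤ 3 * N - 2 := by
    refine (natDegree_sub_le_of_le (natDegree_sub_le_of_le
      (natDegree_mul_le_of_le (natDegree_mul_le_of_le (hd 0) (hn 3).le) (hd 4))
      (natDegree_mul_le_of_le (natDegree_mul_le_of_le (hn 3).le (hd 4)) hH))
      (natDegree_mul_le_of_le (natDegree_mul_le_of_le (hd 4) (hd 4)) hG)).trans ?_
    omega
  have hlt' := degree_lt_degree (show _ < _ from lt_of_le_of_lt hrest
    (by rw [hdeg]; omega : 3 * N - 2 < ((X ^ N + dynPolynomial 3 L) *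
      (X ^ N + dynPolynomial 3 L) * (X ^ N + dynPolynomial 2 L)).natDegree))
  exact ⟨hlead.add_of_left hlt', (natDegree_add_eq_left_of_degree_lt hlt').trans hdeg⟩

variable {L}

/-- If `3 N` zeros of the system have been found with distinct `z`, then all of these are
simple roots of the resultant, and these are all of its roots. -/
lemma roots_of_injective {z : Fin (3 * N) → ℂ} (hinj : Function.Injective z)
    (hroot : ∀ k, (resultantPoly L).IsRoot (z k)) :
    (∀ x, (resultantPoly L).IsRoot x → ∃ k, z k = x) ∧
      ∀ k, (resultantPoly L).derivative.eval (z k) ≠ 0 := by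
  obtain ⟨hm, hdeg⟩ := monic_resultantPoly L
  have hle : Finset.univ.val.map z ≤ (resultantPoly L).roots := by
    rw [Multiset.le_iff_subset ((Multiset.nodup_map_iff_of_injective hinj).2 Finset.univ.nodup)]
    intro x hx
    obtain ⟨k, -, rfl⟩ := Multiset.mem_map.1 hx
    exact (mem_roots hm.ne_zero).2 (hroot k)
  have heq := Multiset.eq_of_le_of_card_le hle
    ((card_roots' _).trans (by rw [hdeg]; simp))
  refine ⟨fun x hx => ?_, fun k hk => ?_⟩
  · obtain ⟨k, -, hk⟩ := Multiset.mem_map.1 (heq ▸ (mem_roots hm.ne_zero).2 hx)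
    exact ⟨k, hk⟩
  · have h1 := (one_lt_rootMultiplicity_iff_isRoot hm.ne_zero).2 ⟨hroot k, hk⟩
    have h2 := Multiset.nodup_iff_count_le_one.1
      (heq ▸ (Multiset.nodup_map_iff_of_injective hinj).2 Finset.univ.nodup :
        (resultantPoly L).roots.Nodup) (z k)
    rw [count_roots] at h2
    omega

lemma isRoot_of_mem_divisorZeros {P : ℂ × ℂ} (h : P ∈ divisorZeros L) :
    (resultantPoly L).IsRoot P.1 := by
  obtain ⟨h₁, h₂⟩ := (mem_divisorZeros_iff L P).1 h
  rw [IsRoot, eval_resultantPoly L P.1 P.2, h₁, h₂]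
  ring

/-- Two zeros over the same `z` force the whole line over `z` to consist of zeros. -/
lemma divisorZeros_of_vertical {z w w' : ℂ} (h : (z, w) ∈ divisorZeros L)
    (h' : (z, w') ∈ divisorZeros L) (hw : w ≠ w') : entry₂₃ L z = 0 ∧ β₃ L z = 0 := by
  obtain ⟨h₁, h₂⟩ := (mem_divisorZeros_iff L _).1 h
  obtain ⟨h₁', h₂'⟩ := (mem_divisorZeros_iff L _).1 h'
  have hw := sub_ne_zero.2 hw
  simp only [minor₁, minor₂, entry₁₁, entry₂₂] at h₁ h₂ h₁' h₂'
  exact ⟨(mul_eq_zero.1 (by linear_combination h₁ - h₁' : (w - w') * _ = 0)).resolve_left hw,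
    (mul_eq_zero.1 (by linear_combination h₂ - h₂' : (w - w') * _ = 0)).resolve_left hw⟩

/-- Over a repeated z both coefficients of w vanish, so every (z, t) is a zero, against finiteness.
-/
lemma fst_injOn_divisorZeros (hfin : (divisorZeros L).Finite) :
    Set.InjOn Prod.fst (divisorZeros L) := by
  rintro ⟨z, w⟩ h ⟨z', w'⟩ h' (rfl : z = z')
  by_contra hne
  obtain ⟨hK, hC⟩ := divisorZeros_of_vertical h h' (fun hw => hne (by rw [hw]))
  refine Set.infinite_of_injective_forall_mem (f := fun t : ℂ => (z, t))
    (fun s t hst => congrArg Prod.snd hst) (fun t => ?_) hfin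
  simp [mem_divisorZeros_iff, minor₁, minor₂, hK, hC]

/-- A family of `3 N` zeros of the system with distinct `z` consists of all zeros, and the
Jacobian does not vanish at any of them. -/
lemma range_eq_divisorZeros {z w : Fin (3 * N) → ℂ} (hinj : Function.Injective z)
    (hmem : ∀ k, (z k, w k) ∈ divisorZeros L) :
    Set.range (fun k => (z k, w k)) = divisorZeros L ∧ ∀ k, jacobian L (z k) (w k) ≠ 0 := by
  obtain ⟨hall, hsimple⟩ := roots_of_injective hinj fun k => isRoot_of_mem_divisorZeros (hmem k)
  have hJ : ∀ k, jacobian L (z k) (w k) ≠ 0 := fun k hk =>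
    hsimple k (by rw [eval_derivative_resultantPoly (hmem k), hk, neg_zero])
  refine ⟨Set.Subset.antisymm (by rintro _ ⟨k, rfl⟩; exact hmem k) ?_, hJ⟩
  rintro ⟨x, v⟩ h
  obtain ⟨k, rfl⟩ := hall x (isRoot_of_mem_divisorZeros h)
  refine ⟨k, ?_⟩
  by_contra hne
  obtain ⟨hK, hC⟩ := divisorZeros_of_vertical (hmem k) h (fun hw => hne (by rw [← hw]))
  -- Both terms of the Jacobian carry a factor `entry₂₃` or `β₃`, so a vertical line of zeros
  -- contradicts simplicity of the root.
  exact hJ k (by rw [jacobian, hK, hC]; ring)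

end Resultant

end Boussinesq

/-! ### Existence, holomorphy and brackets of the divisor coordinates -/

namespace Boussinesq

open Filter Topology

variable {N : ℕ} [NeZero N]

lemma exists_isDivisorCoords (L₀ : DynVars N) (h : (divisorZeros L₀).ncard = 3 * N) :
    ∃ U : Set (DynVars N), IsOpen U ∧ L₀ ∈ U ∧
      ∃ z w : Fin (3 * N) → DynVars N → ℂ, IsDivisorCoords U z w := by
  have hfin : (divisorZeros L₀).Finite := Set.finite_of_ncard_pos (by
    rw [h]; have := NeZero.pos N; omega)
  have hinj := fst_injOn_divisorZeros hfin
  have : Finite (divisorZeros L₀) := hfin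
  let e : Fin (3 * N) ≃ divisorZeros L₀ :=
    ((finCongr h.symm).trans (Finite.equivFin (divisorZeros L₀)).symm)
  have hz : Function.Injective fun k => (e k).1.1 := fun k l hkl =>
    e.injective (Subtype.ext (hinj (e k).2 (e l).2 hkl))
  have hJ := (range_eq_divisorZeros (w := fun k => (e k).1.2) hz fun k => (e k).2).2
  choose ψ ψ' hψ' hψ hev using fun k => exists_implicitFunction (e k).2 (hJ k)
  -- Strict differentiability at the one point gives a Lipschitz bound, hence continuity, on a whole
  -- neighbourhood.
  have hc : ∀ k, ∃ s ∈ 𝓝 L₀, ContinuousOn (ψ k) s := fun k => by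
    obtain ⟨K, s, hs, hK⟩ := (hψ' k).exists_lipschitzOnWith
    exact ⟨s, hs, hK.continuousOn⟩
  choose s hs hcs using hc
  have hmem : ∀ k, ∀ᶠ L in 𝓝 L₀, ψ k L ∈ divisorZeros L := fun k => by
    have ht : Tendsto (fun L => (L, ψ k L)) (𝓝 L₀) (𝓝 (L₀, (e k).1.1, (e k).1.2)) := by
      have := (hψ' k).continuousAt.tendsto
      rw [hψ k] at this
      exact tendsto_id.prodMk_nhds this
    filter_upwards [ht.eventually (hev k)] with L hL using hL.2 rfl
  -- Keeping the z apart is enough: by the degree count, 3N zeros with distinct z are all the zeros.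
  have hne : ∀ k l, k ≠ l → ∀ᶠ L in 𝓝 L₀, (ψ k L).1 ≠ (ψ l L).1 := fun k l hkl => by
    refine (((hψ' k).continuousAt.fst.sub (hψ' l).continuousAt.fst).eventually_ne ?_).mono
      fun L => sub_ne_zero.1
    rw [Pi.sub_apply, hψ, hψ]
    exact sub_ne_zero.2 fun heq => hkl (hz heq)
  have hall : ∀ᶠ L in 𝓝 L₀, (∀ k, L ∈ s k) ∧ (∀ k, ψ k L ∈ divisorZeros L) ∧
      ∀ k l, k ≠ l → (ψ k L).1 ≠ (ψ l L).1 :=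
    (eventually_all.2 hs).and ((eventually_all.2 hmem).and
      (eventually_all.2 fun k => eventually_all.2 fun l => eventually_all.2 fun hkl => hne k l hkl))
  obtain ⟨U, hU, hUo, hLU⟩ := eventually_nhds_iff.1 hall
  refine ⟨U, hUo, hLU, fun k L => (ψ k L).1, fun k L => (ψ k L).2, ?_, ?_, ?_, ?_⟩
  · exact fun k => ((hcs k).mono fun L hL => (hU L hL).1 k).fst
  · exact fun k => ((hcs k).mono fun L hL => (hU L hL).1 k).snd
  · intro L hL k l hkl
    by_contra hne
    exact (hU L hL).2.2 k l hne (congrArg Prod.fst hkl)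
  · intro L hL
    refine (range_eq_divisorZeros (fun k l hkl => ?_) (hU L hL).2.1).1
    by_contra hne
    exact (hU L hL).2.2 k l hne hkl

namespace IsDivisorCoords

variable {U : Set (DynVars N)} {z w : Fin (3 * N) → DynVars N → ℂ}

lemma mem_divisorZeros (h : IsDivisorCoords U z w) {L : DynVars N} (hL : L ∈ U)
    (k : Fin (3 * N)) : (z k L, w k L) ∈ divisorZeros L :=
  h.range_eq L hL ▸ Set.mem_range_self k

lemma injective_z (h : IsDivisorCoords U z w) {L : DynVars N} (hL : L ∈ U) :
    Function.Injective fun k => z k L := fun k l hkl =>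
  h.injective L hL (fst_injOn_divisorZeros (h.range_eq L hL ▸ Set.finite_range _)
    (h.mem_divisorZeros hL k) (h.mem_divisorZeros hL l) hkl)

lemma jacobian_ne_zero (h : IsDivisorCoords U z w) {L : DynVars N} (hL : L ∈ U)
    (k : Fin (3 * N)) : jacobian L (z k L) (w k L) ≠ 0 :=
  (range_eq_divisorZeros (w := fun k => w k L) (h.injective_z hL) (h.mem_divisorZeros hL)).2 k

/-- Continuity keeps the pair inside the region where the implicit function is the only solution, so
the two agree near L. -/
lemma differentiableAt (h : IsDivisorCoords U z w) (hU : IsOpen U) {L : DynVars N} (hL : L ∈ U)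
    (k : Fin (3 * N)) : DifferentiableAt ℂ (z k) L ∧ DifferentiableAt ℂ (w k) L := by
  obtain ⟨ψ, ψ', hψ', -, hev⟩ :=
    exists_implicitFunction (h.mem_divisorZeros hL k) (h.jacobian_ne_zero hL k)
  have hUL := hU.mem_nhds hL
  have ht : Tendsto (fun x => (x, z k x, w k x)) (𝓝 L) (𝓝 (L, z k L, w k L)) :=
    tendsto_id.prodMk_nhds (((h.continuousOn_z k).continuousAt hUL).tendsto.prodMk_nhds
      ((h.continuousOn_w k).continuousAt hUL).tendsto)
  have heq : (fun x => (z k x, w k x)) =ᶠ[𝓝 L] ψ := by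
    filter_upwards [ht.eventually hev, hUL] with x hx hxU
    exact (hx.1 (h.mem_divisorZeros hxU k)).symm
  have hd := hψ'.hasFDerivAt.differentiableAt.congr_of_eventuallyEq heq
  exact ⟨hd.fst, hd.snd⟩

/-- The differentials of the divisor coordinates as combinations of those of the two minors. -/
lemma jacobian_smul_gradient (h : IsDivisorCoords U z w) (hU : IsOpen U) {L : DynVars N}
    (hL : L ∈ U) (k : Fin (3 * N)) :
    jacobian L (z k L) (w k L) • (fun p => partialD (z k) p L)
      = entry₂₃ L (z k L) • covector₂ L (z k L) (w k L)
        - β₃ L (z k L) • covector₁ L (z k L) (w k L) ∧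
    jacobian L (z k L) (w k L) • (fun p => partialD (w k) p L)
      = zDeriv₂ L (z k L) (w k L) • covector₁ L (z k L) (w k L)
        - zDeriv₁ L (z k L) (w k L) • covector₂ L (z k L) (w k L) := by
  obtain ⟨hz, hw⟩ := h.differentiableAt hU hL k
  obtain ⟨h₁, h₂⟩ := covector_eq_of_eventually hz hw
    (Filter.mem_of_superset (hU.mem_nhds hL) fun x hx => h.mem_divisorZeros hx k)
  constructor <;> ext p
  · have e₁ := congrFun h₁ p
    have e₂ := congrFun h₂ p
    simp only [Pi.add_apply, Pi.smul_apply, Pi.sub_apply, Pi.zero_apply, smul_eq_mul,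
      jacobian] at e₁ e₂ ⊢
    linear_combination β₃ L (z k L) * e₁ - entry₂₃ L (z k L) * e₂
  · have e₁ := congrFun h₁ p
    have e₂ := congrFun h₂ p
    simp only [Pi.add_apply, Pi.smul_apply, Pi.sub_apply, Pi.zero_apply, smul_eq_mul,
      jacobian] at e₁ e₂ ⊢
    linear_combination zDeriv₁ L (z k L) (w k L) * e₂ - zDeriv₂ L (z k L) (w k L) * e₁

lemma liePoisson_eq_zero_of_ne (h : IsDivisorCoords U z w) (hU : IsOpen U) {L : DynVars N}
    (hL : L ∈ U) {k l : Fin (3 * N)} (hkl : k ≠ l) :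
    liePoisson (z k) (z l) L = 0 ∧ liePoisson (w k) (w l) L = 0 ∧
      liePoisson (z k) (w l) L = 0 := by
  have hk := h.jacobian_smul_gradient hU hL k
  have hl := h.jacobian_smul_gradient hU hL l
  have hJ : jacobian L (z k L) (w k L) * jacobian L (z l L) (w l L) ≠ 0 :=
    mul_ne_zero (h.jacobian_ne_zero hL k) (h.jacobian_ne_zero hL l)
  obtain ⟨mk₁, mk₂⟩ := (mem_divisorZeros_iff L _).1 (h.mem_divisorZeros hL k)
  obtain ⟨ml₁, ml₂⟩ := (mem_divisorZeros_iff L _).1 (h.mem_divisorZeros hL l)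
  have hne : z k L - z l L ≠ 0 := sub_ne_zero.2 fun e => hkl (h.injective_z hL e)
  have b₁₁ := (mul_eq_zero.1 (poissonForm_covector₁ L (z k L) (z l L) (w k L) (w l L))).resolve_left
    hne
  have b₂₂ := (mul_eq_zero.1 (poissonForm_covector₂ L (z k L) (z l L) (w k L) (w l L))).resolve_left
    hne
  have b₁₂ := (mul_eq_zero.1 ((poissonForm_covector₁_covector₂ L (z k L) (z l L) (w k L)
    (w l L)).trans (by rw [mk₁, mk₂, ml₁, ml₂]; ring))).resolve_left hne
  have b₂₁ := (mul_eq_zero.1 ((poissonForm_covector₁_covector₂ L (z l L) (z k L) (w l L)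
    (w k L)).trans (by rw [mk₁, mk₂, ml₁, ml₂]; ring))).resolve_left (sub_ne_zero.2
      (sub_ne_zero.1 hne).symm)
  have b₂₁' := poissonForm_swap L (covector₂ L (z k L) (w k L)) (covector₁ L (z l L) (w l L))
  rw [b₂₁, neg_zero] at b₂₁'
  -- The gradients are known only after scaling by the Jacobians, which are nonzero and cancel by
  -- bilinearity.
  have key : ∀ g g' : DynVars N,
      poissonForm L (jacobian L (z k L) (w k L) • g) (jacobian L (z l L) (w l L) • g') = 0 →
      poissonForm L g g' = 0 := fun g g' hg => by
    rw [map_smul, map_smul, LinearMap.smul_apply, smul_smul, smul_eq_mul] at hg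
    exact (mul_eq_zero.1 hg).resolve_left (by rwa [mul_comm])
  refine ⟨key _ _ ?_, key _ _ ?_, key _ _ ?_⟩
  · rw [hk.1, hl.1]
    simp [b₁₁, b₂₂, b₁₂, b₂₁']
  · rw [hk.2, hl.2]
    simp [b₁₁, b₂₂, b₁₂, b₂₁']
  · rw [hk.1, hl.2]
    simp [b₁₁, b₂₂, b₁₂, b₂₁']

/-- By skew-symmetry only {m₁, m₂} = z^N J remains, with coefficient the determinant J of the two
gradient formulas; J² then cancels. -/
lemma liePoisson_self (h : IsDivisorCoords U z w) (hU : IsOpen U) {L : DynVars N}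
    (hL : L ∈ U) (k : Fin (3 * N)) : liePoisson (z k) (w k) L = z k L ^ N := by
  have hk := h.jacobian_smul_gradient hU hL k
  have hJ := h.jacobian_ne_zero hL k
  obtain ⟨m₁, m₂⟩ := (mem_divisorZeros_iff L _).1 (h.mem_divisorZeros hL k)
  have b := poissonForm_covector_self m₁ m₂
  have b' := poissonForm_swap L (covector₂ L (z k L) (w k L)) (covector₁ L (z k L) (w k L))
  rw [b] at b'
  rw [liePoisson_eq]
  have e := congrArg₂ (fun g g' => poissonForm L g g') hk.1 hk.2
  simp only [map_smul, map_sub, LinearMap.smul_apply, LinearMap.sub_apply, smul_eq_mul,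
    poissonForm_self, b, b'] at e
  refine mul_left_cancel₀ (mul_ne_zero hJ hJ) ?_
  have hdef : jacobian L (z k L) (w k L) = zDeriv₁ L (z k L) (w k L) * β₃ L (z k L)
    - entry₂₃ L (z k L) * zDeriv₂ L (z k L) (w k L) := rfl
  linear_combination e - z k L ^ N * jacobian L (z k L) (w k L) * hdef

end IsDivisorCoords

end Boussinesq

end

theorem mainTheorem3 (N : ℕ) [NeZero N] :
    -- near a point whose system has `3N` zeros, the coordinates of these are functions on `𝓜_N`
    (∀ L₀ : Boussinesq.DynVars N, (Boussinesq.divisorZeros L₀).ncard = 3 * N →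
      ∃ U : Set (Boussinesq.DynVars N), IsOpen U ∧ L₀ ∈ U ∧
        ∃ z w : Fin (3 * N) → Boussinesq.DynVars N → ℂ, Boussinesq.IsDivisorCoords U z w) ∧
    -- all such functions are holomorphic and quasi-canonically conjugate
    (∀ (U : Set (Boussinesq.DynVars N)) (z w : Fin (3 * N) → Boussinesq.DynVars N → ℂ),
      IsOpen U → Boussinesq.IsDivisorCoords U z w →
        (∀ k, DifferentiableOn ℂ (z k) U ∧ DifferentiableOn ℂ (w k) U) ∧
        ∀ L ∈ U, ∀ k l : Fin (3 * N),
          Boussinesq.liePoisson (z k) (z l) L = 0 ∧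
          Boussinesq.liePoisson (w k) (w l) L = 0 ∧
          Boussinesq.liePoisson (z k) (w l) L = if k = l then z k L ^ N else 0) := by
  refine ⟨Boussinesq.exists_isDivisorCoords, fun U z w hU h => ⟨fun k =>
    ⟨fun L hL => (h.differentiableAt hU hL k).1.differentiableWithinAt,
      fun L hL => (h.differentiableAt hU hL k).2.differentiableWithinAt⟩, fun L hL k l => ?_⟩⟩
  rcases eq_or_ne k l with rfl | hkl
  · rw [if_pos rfl]
    exact ⟨Boussinesq.poissonForm_self L _, Boussinesq.poissonForm_self L _,
      h.liePoisson_self hU hL k⟩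
  · rw [if_neg hkl]
    exact h.liePoisson_eq_zero_of_ne hU hL hkl
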